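/- **Setting.** ABS is an active object language. Objects communicate by asynchronous calls $f=o!m(\bar e)$; each call creates a process on $o$ and a future $f$ that this process resolves with its return value. At most one process at a time has control of an object. It gives control up only by terminating, by `suspend`, or at an `await`. A synchronous call on `this` is executed inside the calling process; a synchronous call on another object is an asynchronous call followed by `get`. The statement $x=f.\mathtt{get}$ keeps control of the object and blocks until $f$ is resolved. The statement $\mathtt{await}\ g$, where $g$ is built from tests $f?$ and Boolean conditions by conjunction, releases the object; the process may take control again when $g$ holds and the object is idle. Creating an object runs its initialization and then starts its method `run`, if it has one. A program consists of classes and a main block; its reachable states are those that can be reached from the initial state, in which only the main block is running. **The class `Mem`.** Its fields are `list` (pending accesses $\mathtt{Write}(t,loc,val,id)$ and $\mathtt{Read}(t,loc,id)$, initially empty), `counter` (initially $0$), `done` (set of identifiers, initially empty), `mem` (map from locations to values) and `ret` (map from identifiers to values, initially empty). Its methods are: - `read(t,loc)`: appends $\mathtt{Read}(t,loc,id)$ to `list`, with $id$ the value of `counter`, increments `counter`, and returns the future of the call `this!internalRead(id)`; - `internalRead(id)`: `await contains(done,id); return lookupUnsafe(ret,id);` - `write(t,loc,val)`: appends $\mathtt{Write}(t,loc,val,id)$,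 with $id$ the value of `counter`, and increments `counter`; - `const(i)`: returns $i$; - `run()`: forever executes `await list != Nil;`, computes by `this.strategy()` the list of positions that may be executed next, chooses a position from it, obtains the access at this position (and, for a read, the value given by `getValueFor`) while removing it from `list` by `this.getAccess(pos)`, adds its identifier to `done`, and stores the value in `mem` for a write and in `ret` for a read; - `strategy()`: returns the positions $i$ such that `maySwap(list[j],list[i])` is true for all $j<i$; - `maySwap(a,b)`: in the core model, true iff $a$ and $b$ are from different threads. In the variants with write-write (write-read) relaxation it is also true if $a$ is a write, $b$ is a write (a read), and their locations differ. In the variants with early reads it is also true if $a$ is a write and $b$ a read at the same location; - `getValueFor(t,loc,pos)`: looks $loc$ up in `mem`; in the variants with early reads it first looks for the last write of $t$ to $loc$ in `list` before position $pos$ and returns its value if there is one. The variant (any combination of the three relaxations), the initial contents of `mem`, and the function choosing a position are arbitrary. **Deadlocks.** In a given state, a process $p$ is *halting* if either it has control of its object and is at a `get` on an unresolved future, or it is at an `await`, has released its object, and cannot continue because the guard does not hold or the object is not idle. A process $p_1$ *depends on* a process $p_2$ if $p_1$ is halting and execution of $p_2$ would allow $p_1$ to continue. That is, some hypothetical execution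 of $p_2$ from this state has a step of $p_2$ that makes $p_1$ able to continue after its `get` or `await`, while $p_1$ could not continue before. As $p_2$ may be halting itself, its surroundings may change during this execution so as to provide what $p_2$ waits for: fields, control of objects, futures and other processes may change arbitrarily, except that $p_1$ and $p_2$ themselves, the classes of objects, the values of resolved futures, the set of existing objects of which $p_2$ has control and the fields of these objects stay the same, as does the truth of the condition (future resolved, or guard satisfied) for which $p_1$ waits. A *deadlock* is a circular dependency between at least two processes: distinct processes $p_0,\dots,p_{k-1}$, $k\ge 2$, such that $p_i$ depends on $p_{i+1 \bmod k}$ for all $i$. **Lemma.** Let $P$ be an ABS program that contains the class `Mem`. No reachable state of $P$ contains a deadlock all of whose processes run on instances of `Mem` (the same instance or different ones). This holds for every such program, whether or not it is well typed. -/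

import Mathlib

namespace ABS

/-! ## Names, values and pure expressions -/

/-- Names of classes, methods, fields, local variables and data constructors.  The names that occur
in the class `Mem` are listed; every other name of a program is some `user n`. -/
inductive Ident
  -- class and methods
  | Mem | run | read | write | const | internalRead | strategy | getAccess
  | maySwap | maySwapVersion (n : ℕ) | getValueFor | getValueForCore
  -- fields
  | list | counter | done | mem | ret
  -- local variables
  | t | loc | val | i | j | myId | accList | pp | id | allowed | add | b | pos | acc | value
  | a | tid | loca | locb | last | result
  -- data constructors
  | Nil | Cons | EmptySet | Insert | EmptyMap | InsertAssoc | Pair | Just | Nothing | Read | Write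
  -- all other names
  | user (n : ℕ)
  deriving DecidableEq

/-- Object identities. -/
abbrev Oid := ℕ

/-- Process identities.  Every asynchronous call creates one process and one future, so a future is
identified by the process that resolves it. -/
abbrev Pid := ℕ

/-- Run-time values: primitive values, references, futures and terms of algebraic data types. -/
inductive Value
  | unit
  | null
  | bool (b : Bool)
  | int (n : ℤ)
  | rat (q : ℚ)
  | str (s : String)
  | obj (o : Oid)
  | fut (p : Pid)
  | data (c : Ident) (args : List Value)

abbrev Store := Ident → Option Value

/-- What an expression of a process may depend on. -/
structure Env where
  self : Oid
  locals : Store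
  fields : Store

/-- Side-effect free expressions.  A function of the functional sublanguage is represented by its
denotation: the set of results it may return on given arguments.  This set is empty where the
function is undefined (a failing `case`, `nth` out of range, …), and it has several elements for
functions such as `random`. -/
inductive Expr
  | lit (v : Value)
  | this
  | var (x : Ident)
  | field (x : Ident)
  | app (f : List Value → Set Value) (args : List Expr)

mutual

/-- The possible values of an expression. -/
def Expr.vals (env : Env) : Expr → Set Value
  | .lit v => {v}
  | .this => {.obj env.self}
  | .var x => {v | env.locals x = some v}
  | .field x => {v | env.fields x = some v}
  | .app f args => {v | ∃ vs ∈ Expr.valsList env args, v ∈ f vs}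

/-- The possible values of a list of expressions. -/
def Expr.valsList (env : Env) : List Expr → Set (List Value)
  | [] => {[]}
  | e :: es => {l | ∃ v ∈ Expr.vals env e, ∃ vs ∈ Expr.valsList env es, l = v :: vs}

end

/-! ## Statements, classes and programs -/

/-- Patterns of `case` branches; `bound x` is an occurrence of a variable that already has a
value. -/
inductive Pattern
  | wild
  | bind (x : Ident)
  | bound (x : Ident)
  | lit (v : Value)
  | con (c : Ident) (ps : List Pattern)

section

open Classical

mutual

/-- Matching a value against a pattern, extending the local variables by the variables bound. -/
noncomputable def Pattern.matches : Pattern → Value → Store → Option Store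
  | .wild, _, σ => some σ
  | .bind x, v, σ => some (Function.update σ x (some v))
  | .bound x, v, σ => if σ x = some v then some σ else none
  | .lit w, v, σ => if w = v then some σ else none
  | .con c ps, v, σ =>
      match v with
      | .data c' vs => if c = c' then Pattern.matchesList ps vs σ else none
      | _ => none

noncomputable def Pattern.matchesList : List Pattern → List Value → Store → Option Store
  | [], [], σ => some σ
  | p :: ps, v :: vs, σ => (Pattern.matches p v σ).bind (Pattern.matchesList ps vs)
  | _, _, _ => none

end

end

/-- Target of an assignment. -/
inductive LVal
  | discard
  | var (x : Ident)
  | field (x : Ident)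

/-- Guards of `await`: `f?`, a Boolean condition, or a conjunction. -/
inductive Guard
  | fut (e : Expr)
  | cond (e : Expr)
  | and (g₁ g₂ : Guard)

/-- Right-hand sides of assignments: a pure expression, `e!m(args)`, `e.m(args)`, `new C(args)` and
`e.get`. -/
inductive Rhs
  | pure (e : Expr)
  | call (e : Expr) (m : Ident) (args : List Expr)
  | sync (e : Expr) (m : Ident) (args : List Expr)
  | new (C : Ident) (args : List Expr)
  | get (e : Expr)

/-- Statements.  `caseOf e p s₁ s₂` is `case e { p => s₁; _ => s₂ }`, further branches are nested in
`s₂`; if no branch is left, `abort` has no transition.  `fetch x q` is the run-time form of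
`x = e.get` once `e` has been evaluated to the future of process `q`. -/
inductive Stmt
  | skip
  | abort
  | seq (s₁ s₂ : Stmt)
  | assign (x : LVal) (r : Rhs)
  | fetch (x : LVal) (q : Pid)
  | await (g : Guard)
  | suspend
  | ite (e : Expr) (s₁ s₂ : Stmt)
  | while (e : Expr) (s : Stmt)
  | caseOf (e : Expr) (p : Pattern) (s₁ s₂ : Stmt)
  | return (e : Expr)

structure Method where
  params : List Ident
  body : Stmt

/-- A class.  Class parameters become fields; `init` consists of the field initializers and the
initialization block. -/
structure ClassDecl where
  params : List Ident
  init : Stmt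
  methods : Ident → Option Method

structure Program where
  classes : Ident → Option ClassDecl
  main : Stmt

/-! ## States -/

/-- An activation record: local variables, the statements still to be executed, and the place where
the caller in the same process stores the returned value. -/
structure Frame where
  locals : Store
  code : List Stmt
  dest : LVal

/-- A process runs on one object; its stack has more than one frame during synchronous calls on
`this`, and no frame once the process has terminated. -/
structure Proc where
  obj : Oid
  frames : List Frame

/-- An object: its class (`none` for the object of the main block), its fields, and the process that
has control of it, if any. -/
structure Obj where
  cls : Option Ident
  fields : Store
  active : Option Pid

/-- A global state: objects, processes, and the values of the resolved futures. -/
structure State where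
  objs : Oid → Option Obj
  procs : Pid → Option Proc
  futs : Pid → Option Value

def State.setObj (s : State) (o : Oid) (ob : Obj) : State :=
  { s with objs := Function.update s.objs o (some ob) }

def State.setProc (s : State) (p : Pid) (pr : Proc) : State :=
  { s with procs := Function.update s.procs p (some pr) }

def State.setFut (s : State) (p : Pid) (v : Value) : State :=
  { s with futs := Function.update s.futs p (some v) }

/-- Bindings of formal to actual parameters. -/
def bindParams : List Ident → List Value → Store
  | x :: xs, v :: vs => Function.update (bindParams xs vs) x (some v)
  | _, _ => fun _ => none

def LVal.putLocal : LVal → Value → Store → Store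
  | .var x, v, σ => Function.update σ x (some v)
  | _, _, σ => σ

def LVal.putField : LVal → Value → Store → Store
  | .field x, v, σ => Function.update σ x (some v)
  | _, _, σ => σ

/-- The guard may be passed. -/
def Guard.Ready (futs : Pid → Option Value) (env : Env) : Guard → Prop
  | .fut e => ∃ q, Value.fut q ∈ e.vals env ∧ (futs q).isSome
  | .cond e => Value.bool true ∈ e.vals env
  | .and g₁ g₂ => g₁.Ready futs env ∧ g₂.Ready futs env

/-! ## Operational semantics -/

/-- Methods of an object of class `C`. -/
def Program.method (P : Program) (C : Option Ident) (m : Ident) : Option Method :=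
  C.bind fun C => (P.classes C).bind fun cd => cd.methods m

/-- The process created by an asynchronous call. -/
def Method.start (md : Method) (o : Oid) (vs : List Value) : Proc :=
  ⟨o, [⟨bindParams md.params vs, [md.body], .discard⟩]⟩

/-- The process that initializes a new object and then, if there is a method `run`, starts it. -/
def ClassDecl.start (cd : ClassDecl) (o : Oid) : Proc :=
  ⟨o, [⟨fun _ => none,
    match cd.methods .run with
    | some _ => [cd.init, .assign .discard (.call .this .run [])]
    | none => [cd.init], .discard⟩]⟩

/-- Sequential steps of the process that has control of object `self`, on the fields of this object
and the stack of the process.  `meth` is the method table of the object. -/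
inductive LocalStep (meth : Ident → Option Method) (self : Oid) :
    Store → List Frame → Store → List Frame → Prop
  | skip {φ σ k d fs} :
      LocalStep meth self φ (⟨σ, .skip :: k, d⟩ :: fs) φ (⟨σ, k, d⟩ :: fs)
  | seq {φ σ s₁ s₂ k d fs} :
      LocalStep meth self φ (⟨σ, .seq s₁ s₂ :: k, d⟩ :: fs) φ (⟨σ, s₁ :: s₂ :: k, d⟩ :: fs)
  | assign {φ σ x e v k d fs} (hv : v ∈ e.vals ⟨self, σ, φ⟩) :
      LocalStep meth self φ (⟨σ, .assign x (.pure e) :: k, d⟩ :: fs)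
        (x.putField v φ) (⟨x.putLocal v σ, k, d⟩ :: fs)
  | iteTrue {φ σ e s₁ s₂ k d fs} (hv : Value.bool true ∈ e.vals ⟨self, σ, φ⟩) :
      LocalStep meth self φ (⟨σ, .ite e s₁ s₂ :: k, d⟩ :: fs) φ (⟨σ, s₁ :: k, d⟩ :: fs)
  | iteFalse {φ σ e s₁ s₂ k d fs} (hv : Value.bool false ∈ e.vals ⟨self, σ, φ⟩) :
      LocalStep meth self φ (⟨σ, .ite e s₁ s₂ :: k, d⟩ :: fs) φ (⟨σ, s₂ :: k, d⟩ :: fs)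
  | whileTrue {φ σ e st k d fs} (hv : Value.bool true ∈ e.vals ⟨self, σ, φ⟩) :
      LocalStep meth self φ (⟨σ, .while e st :: k, d⟩ :: fs)
        φ (⟨σ, st :: .while e st :: k, d⟩ :: fs)
  | whileFalse {φ σ e st k d fs} (hv : Value.bool false ∈ e.vals ⟨self, σ, φ⟩) :
      LocalStep meth self φ (⟨σ, .while e st :: k, d⟩ :: fs) φ (⟨σ, k, d⟩ :: fs)
  | caseMatch {φ σ σ' e p s₁ s₂ v k d fs} (hv : v ∈ e.vals ⟨self, σ, φ⟩)
      (hm : p.matches v σ = some σ') :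
      LocalStep meth self φ (⟨σ, .caseOf e p s₁ s₂ :: k, d⟩ :: fs) φ (⟨σ', s₁ :: k, d⟩ :: fs)
  | caseElse {φ σ e p s₁ s₂ v k d fs} (hv : v ∈ e.vals ⟨self, σ, φ⟩)
      (hm : p.matches v σ = none) :
      LocalStep meth self φ (⟨σ, .caseOf e p s₁ s₂ :: k, d⟩ :: fs) φ (⟨σ, s₂ :: k, d⟩ :: fs)
  | selfCall {φ σ x e m args vs md k d fs} (ho : Value.obj self ∈ e.vals ⟨self, σ, φ⟩)
      (hvs : vs ∈ Expr.valsList ⟨self, σ, φ⟩ args) (hm : meth m = some md)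
      (hl : vs.length = md.params.length) :
      LocalStep meth self φ (⟨σ, .assign x (.sync e m args) :: k, d⟩ :: fs)
        φ (⟨bindParams md.params vs, [md.body], x⟩ :: ⟨σ, k, d⟩ :: fs)
  | ret {φ σ e v k x σ' k' d fs} (hv : v ∈ e.vals ⟨self, σ, φ⟩) :
      LocalStep meth self φ (⟨σ, .return e :: k, x⟩ :: ⟨σ', k', d⟩ :: fs)
        (x.putField v φ) (⟨x.putLocal v σ', k', d⟩ :: fs)
  | retUnit {φ σ x σ' k' d fs} :
      LocalStep meth self φ (⟨σ, [], x⟩ :: ⟨σ', k', d⟩ :: fs)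
        (x.putField .unit φ) (⟨x.putLocal .unit σ', k', d⟩ :: fs)

/-- `Step P p s s'`: process `p` takes one step, which leads from state `s` to state `s'`. -/
inductive Step (P : Program) (p : Pid) : State → State → Prop
  | local {s o ob φ fs fs'}
      (hp : s.procs p = some ⟨o, fs⟩) (ho : s.objs o = some ob) (ha : ob.active = some p)
      (hl : LocalStep (P.method ob.cls) o ob.fields fs φ fs') :
      Step P p s ((s.setObj o { ob with fields := φ }).setProc p ⟨o, fs'⟩)
  /-- `x = e!m(args)` -/
  | call {s o ob σ x e m args k d fs o' ob' md vs q}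
      (hp : s.procs p = some ⟨o, ⟨σ, .assign x (.call e m args) :: k, d⟩ :: fs⟩)
      (ho : s.objs o = some ob) (ha : ob.active = some p)
      (he : Value.obj o' ∈ e.vals ⟨o, σ, ob.fields⟩)
      (hvs : vs ∈ Expr.valsList ⟨o, σ, ob.fields⟩ args)
      (ho' : s.objs o' = some ob') (hm : P.method ob'.cls m = some md)
      (hl : vs.length = md.params.length)
      (hq : s.procs q = none) (hq' : s.futs q = none) :
      Step P p s (((s.setObj o { ob with fields := x.putField (.fut q) ob.fields }).setProc p
        ⟨o, ⟨x.putLocal (.fut q) σ, k, d⟩ :: fs⟩).setProc q (md.start o' vs))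
  /-- `x = e.m(args)` on another object: an asynchronous call followed by `get` -/
  | remoteSync {s o ob σ x e m args k d fs o' ob' md vs q}
      (hp : s.procs p = some ⟨o, ⟨σ, .assign x (.sync e m args) :: k, d⟩ :: fs⟩)
      (ho : s.objs o = some ob) (ha : ob.active = some p)
      (he : Value.obj o' ∈ e.vals ⟨o, σ, ob.fields⟩) (hne : o' ≠ o)
      (hvs : vs ∈ Expr.valsList ⟨o, σ, ob.fields⟩ args)
      (ho' : s.objs o' = some ob') (hm : P.method ob'.cls m = some md)
      (hl : vs.length = md.params.length)
      (hq : s.procs q = none) (hq' : s.futs q = none) :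
      Step P p s ((s.setProc p ⟨o, ⟨σ, .fetch x q :: k, d⟩ :: fs⟩).setProc q (md.start o' vs))
  /-- `x = new C(args)` -/
  | new {s o ob σ x C args k d fs o' cd vs q}
      (hp : s.procs p = some ⟨o, ⟨σ, .assign x (.new C args) :: k, d⟩ :: fs⟩)
      (ho : s.objs o = some ob) (ha : ob.active = some p)
      (hvs : vs ∈ Expr.valsList ⟨o, σ, ob.fields⟩ args)
      (hC : P.classes C = some cd) (hl : vs.length = cd.params.length)
      (ho' : s.objs o' = none) (hq : s.procs q = none) (hq' : s.futs q = none) :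
      Step P p s ((((s.setObj o { ob with fields := x.putField (.obj o') ob.fields }).setProc p
        ⟨o, ⟨x.putLocal (.obj o') σ, k, d⟩ :: fs⟩).setObj o'
          ⟨some C, bindParams cd.params vs, some q⟩).setProc q (cd.start o'))
  /-- `x = e.get`: evaluation of `e` -/
  | get {s o ob σ x e k d fs q}
      (hp : s.procs p = some ⟨o, ⟨σ, .assign x (.get e) :: k, d⟩ :: fs⟩)
      (ho : s.objs o = some ob) (ha : ob.active = some p)
      (he : Value.fut q ∈ e.vals ⟨o, σ, ob.fields⟩) :
      Step P p s (s.setProc p ⟨o, ⟨σ, .fetch x q :: k, d⟩ :: fs⟩)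
  /-- `x = e.get`: reading the resolved future -/
  | fetch {s o ob σ x k d fs q v}
      (hp : s.procs p = some ⟨o, ⟨σ, .fetch x q :: k, d⟩ :: fs⟩)
      (ho : s.objs o = some ob) (ha : ob.active = some p)
      (hv : s.futs q = some v) :
      Step P p s ((s.setObj o { ob with fields := x.putField v ob.fields }).setProc p
        ⟨o, ⟨x.putLocal v σ, k, d⟩ :: fs⟩)
  /-- `suspend` -/
  | suspend {s o ob σ k d fs}
      (hp : s.procs p = some ⟨o, ⟨σ, .suspend :: k, d⟩ :: fs⟩)
      (ho : s.objs o = some ob) (ha : ob.active = some p) :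
      Step P p s ((s.setObj o { ob with active := none }).setProc p ⟨o, ⟨σ, k, d⟩ :: fs⟩)
  /-- `await g` releases control; the process stays at this statement until it is resumed -/
  | release {s o ob σ g k d fs}
      (hp : s.procs p = some ⟨o, ⟨σ, .await g :: k, d⟩ :: fs⟩)
      (ho : s.objs o = some ob) (ha : ob.active = some p) :
      Step P p s (s.setObj o { ob with active := none })
  /-- a process waiting at `await g` takes control of an idle object once `g` holds -/
  | resume {s o ob σ g k d fs}
      (hp : s.procs p = some ⟨o, ⟨σ, .await g :: k, d⟩ :: fs⟩)
      (ho : s.objs o = some ob) (ha : ob.active = none)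
      (hg : g.Ready s.futs ⟨o, σ, ob.fields⟩) :
      Step P p s ((s.setObj o { ob with active := some p }).setProc p ⟨o, ⟨σ, k, d⟩ :: fs⟩)
  /-- any other unfinished process may take control of an idle object -/
  | activate {s o ob σ k d fs}
      (hp : s.procs p = some ⟨o, ⟨σ, k, d⟩ :: fs⟩)
      (hk : ∀ g k', k ≠ .await g :: k')
      (ho : s.objs o = some ob) (ha : ob.active = none) :
      Step P p s (s.setObj o { ob with active := some p })
  /-- termination by `return e` -/
  | finish {s o ob σ e v k d}
      (hp : s.procs p = some ⟨o, [⟨σ, .return e :: k, d⟩]⟩)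
      (ho : s.objs o = some ob) (ha : ob.active = some p)
      (hv : v ∈ e.vals ⟨o, σ, ob.fields⟩) :
      Step P p s (((s.setObj o { ob with active := none }).setProc p ⟨o, []⟩).setFut p v)
  /-- termination at the end of a body without `return` -/
  | finishUnit {s o ob σ d}
      (hp : s.procs p = some ⟨o, [⟨σ, [], d⟩]⟩)
      (ho : s.objs o = some ob) (ha : ob.active = some p) :
      Step P p s (((s.setObj o { ob with active := none }).setProc p ⟨o, []⟩).setFut p .unit)

/-- Initially there is one object without a class, on which the main block runs. -/
def Program.initial (P : Program) : State where
  objs := Function.update (fun _ => none) 0 (some ⟨none, fun _ => none, some 0⟩)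
  procs := Function.update (fun _ => none) 0
    (some ⟨0, [⟨fun _ => none, [P.main], .discard⟩]⟩)
  futs := fun _ => none

/-- States that some execution of the program reaches. -/
def Reachable (P : Program) (s : State) : Prop :=
  Relation.ReflTransGen (fun s s' => ∃ p, Step P p s s') P.initial s

/-! ## Deadlocks -/

/-- The next statement of `p` is `get` on the future of `q`. -/
def State.NextGet (s : State) (p q : Pid) : Prop :=
  ∃ o σ x k d fs, s.procs p = some ⟨o, ⟨σ, .fetch x q :: k, d⟩ :: fs⟩

/-- The next statement of `p`, on an object that is in state `ob`, is `await g`, to be evaluated in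
the environment `env`. -/
def State.NextAwait (s : State) (p : Pid) (ob : Obj) (g : Guard) (env : Env) : Prop :=
  ∃ o σ k d fs, s.procs p = some ⟨o, ⟨σ, .await g :: k, d⟩ :: fs⟩ ∧
    s.objs o = some ob ∧ env = ⟨o, σ, ob.fields⟩

/-- `p` has control of its object. -/
def State.Holds (s : State) (p : Pid) : Prop :=
  ∃ pr ob, s.procs p = some pr ∧ s.objs pr.obj = some ob ∧ ob.active = some p

/-- The condition for which `p` waits at its `get` or `await` statement is satisfied. -/
def State.CondHolds (s : State) (p : Pid) : Prop :=
  (∃ q, s.NextGet p q ∧ (s.futs q).isSome) ∨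
  (∃ ob g env, s.NextAwait p ob g env ∧ g.Ready s.futs env)

/-- `p` may continue after its `get` or `await` statement: at a `get` the future is resolved, at an
`await` the guard holds and the object is idle. -/
def State.MayContinue (s : State) (p : Pid) : Prop :=
  (∃ q, s.NextGet p q ∧ (s.futs q).isSome) ∨
  (∃ ob g env, s.NextAwait p ob g env ∧ g.Ready s.futs env ∧ ob.active = none)

/-- `p` halts at a `get` statement, blocking its object, or at an `await` statement, where it has
released its object, and cannot continue. -/
def State.Halting (s : State) (p : Pid) : Prop :=
  ((∃ q, s.NextGet p q ∧ s.Holds p) ∨ (∃ ob g env, s.NextAwait p ob g env ∧ ¬ s.Holds p)) ∧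
    ¬ s.MayContinue p

/-- A hypothetical change of the state around `p₁` and `p₂`, by which whatever `p₂` waits for may be
provided: fields, control of objects, futures and other processes may change arbitrarily, but not
the processes `p₁` and `p₂` themselves, nor which objects `p₂` has control of, nor the fields of these
objects.  Classes of objects and values of resolved futures persist.  The change does not affect
whether the condition for which `p₁` waits is satisfied. -/
structure Interference (p₁ p₂ : Pid) (s s' : State) : Prop where
  proc_left : s'.procs p₁ = s.procs p₁
  proc_right : s'.procs p₂ = s.procs p₂
  futs : ∀ q v, s.futs q = some v → s'.futs q = some v
  objs : ∀ o ob, s.objs o = some ob → ∃ ob', s'.objs o = some ob' ∧ ob'.cls = ob.cls ∧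
    (ob'.active = some p₂ ↔ ob.active = some p₂) ∧ (ob.active = some p₂ → ob'.fields = ob.fields)
  cond : s'.CondHolds p₁ ↔ s.CondHolds p₁

/-- Hypothetical executions of `p₂`, interleaved with changes of its surroundings, during which `p₁`
is never able to continue (after the first state). -/
inductive Execution (P : Program) (p₁ p₂ : Pid) : State → State → Prop
  | refl (s) : Execution P p₁ p₂ s s
  | step {s t u} : Execution P p₁ p₂ s t → Step P p₂ t u → ¬ u.MayContinue p₁ →
      Execution P p₁ p₂ s u
  | change {s t u} : Execution P p₁ p₂ s t → Interference p₁ p₂ t u → ¬ u.MayContinue p₁ →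
      Execution P p₁ p₂ s u

/-- In state `s`, process `p₁` depends on `p₂`: it halts at a `get` or `await` statement, and
execution of `p₂` would allow it to continue.  As `p₂` may itself be halting, its execution is
hypothetical; the step that makes `p₁` able to continue is a step of `p₂`. -/
def DependsOn (P : Program) (s : State) (p₁ p₂ : Pid) : Prop :=
  s.Halting p₁ ∧ ∃ t u, Execution P p₁ p₂ s t ∧ Step P p₂ t u ∧ u.MayContinue p₁

/-- A deadlock: a circular dependency between at least two processes (the successor of the last
index of `Fin (n + 2)` is `0`). -/
def IsDeadlock (P : Program) (s : State) {n : ℕ} (c : Fin (n + 2) → Pid) : Prop :=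
  Function.Injective c ∧ ∀ i, DependsOn P s (c i) (c (i + 1))

/-- `p` is a process on an instance of class `C`. -/
def State.RunsOn (s : State) (p : Pid) (C : Ident) : Prop :=
  ∃ pr ob, s.procs p = some pr ∧ s.objs pr.obj = some ob ∧ ob.cls = some C

/-! ## Library functions -/

/-- Elements of a term `cons(x₁, cons(x₂, … nil))`. -/
def Value.elems (nil cons : Ident) : Value → Option (List Value)
  | .data c [] => if c = nil then some [] else none
  | .data c [x, l] => if c = cons then (l.elems nil cons).map (x :: ·) else none
  | _ => none

def Value.ofElems (nil cons : Ident) : List Value → Value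
  | [] => .data nil []
  | x :: l => .data cons [x, Value.ofElems nil cons l]

/-- Lists, sets and maps are algebraic data types; a map is a list of pairs. -/
def Value.toList : Value → Option (List Value) := Value.elems .Nil .Cons
def Value.ofList : List Value → Value := Value.ofElems .Nil .Cons
def Value.toSet : Value → Option (List Value) := Value.elems .EmptySet .Insert
def Value.toMap : Value → Option (List Value) := Value.elems .EmptyMap .InsertAssoc

/-- Denotation of a partial function on values. -/
def fn1 (f : Value → Option Value) : List Value → Set Value
  | [x] => {v | f x = some v}
  | _ => ∅

def fn2 (f : Value → Value → Option Value) : List Value → Set Value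
  | [x, y] => {v | f x y = some v}
  | _ => ∅

def fn3 (f : Value → Value → Value → Option Value) : List Value → Set Value
  | [x, y, z] => {v | f x y z = some v}
  | _ => ∅

/-- Application of a data constructor. -/
def con (c : Ident) (args : List Expr) : Expr := .app (fun vs => {.data c vs}) args

noncomputable section

open Classical

def eq (e₁ e₂ : Expr) : Expr := .app (fn2 fun x y => some (.bool (decide (x = y)))) [e₁, e₂]

def ne (e₁ e₂ : Expr) : Expr := .app (fn2 fun x y => some (.bool (decide (x ≠ y)))) [e₁, e₂]

def not (e : Expr) : Expr :=
  .app (fn1 fun | .bool x => some (.bool (!x)) | _ => none) [e]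

def or (e₁ e₂ : Expr) : Expr :=
  .app (fn2 fun | .bool x, .bool y => some (.bool (x || y)) | _, _ => none) [e₁, e₂]

def lt (e₁ e₂ : Expr) : Expr :=
  .app (fn2 fun | .int x, .int y => some (.bool (decide (x < y))) | _, _ => none) [e₁, e₂]

def plus (e₁ e₂ : Expr) : Expr :=
  .app (fn2 fun | .int x, .int y => some (.int (x + y)) | _, _ => none) [e₁, e₂]

def minus (e₁ e₂ : Expr) : Expr :=
  .app (fn2 fun | .int x, .int y => some (.int (x - y)) | _, _ => none) [e₁, e₂]

def int (n : ℤ) : Expr := .lit (.int n)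

def length (e : Expr) : Expr := .app (fn1 fun l => l.toList.map fun l => .int l.length) [e]

def appendright (e₁ e₂ : Expr) : Expr :=
  .app (fn2 fun l x => l.toList.map fun l => Value.ofList (l ++ [x])) [e₁, e₂]

def nth (e₁ e₂ : Expr) : Expr :=
  .app (fn2 fun
    | l, .int n => l.toList.bind fun l => if 0 ≤ n then l[n.toNat]? else none
    | _, _ => none) [e₁, e₂]

/-- The list without the element at the given position. -/
def removeAt (e₁ e₂ : Expr) : Expr :=
  .app (fn2 fun
    | l, .int n => l.toList.map fun l => Value.ofList (if 0 ≤ n then l.eraseIdx n.toNat else l)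
    | _, _ => none) [e₁, e₂]

/-- The elements at the positions from `e₂` to `e₃`. -/
def slice (e₁ e₂ e₃ : Expr) : Expr :=
  .app (fn3 fun
    | l, .int m, .int n => l.toList.map fun l =>
        Value.ofList ((l.take (n + 1).toNat).drop m.toNat)
    | _, _, _ => none) [e₁, e₂, e₃]

def contains (e₁ e₂ : Expr) : Expr :=
  .app (fn2 fun s x => s.toSet.map fun s => .bool (decide (x ∈ s))) [e₁, e₂]

def insertElement (e₁ e₂ : Expr) : Expr :=
  .app (fn2 fun s x => s.toSet.map fun l => if x ∈ l then s else .data .Insert [x, s]) [e₁, e₂]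

/-- A later `put` shadows the earlier ones. -/
def put (e₁ e₂ e₃ : Expr) : Expr :=
  .app (fn3 fun m x y => some (.data .InsertAssoc [.data .Pair [x, y], m])) [e₁, e₂, e₃]

def lookupUnsafe (e₁ e₂ : Expr) : Expr :=
  .app (fn2 fun m x => m.toMap.bind fun m => m.findSome? fun
    | .data .Pair [k, v] => if k = x then some v else none
    | _ => none) [e₁, e₂]

def fst (e : Expr) : Expr := .app (fn1 fun | .data .Pair [x, _] => some x | _ => none) [e]

def snd (e : Expr) : Expr := .app (fn1 fun | .data .Pair [_, y] => some y | _ => none) [e]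

/-- The thread of an access `Write(tid, loc, value, id)` or `Read(tid, loc, id)`. -/
def tidOf (e : Expr) : Expr :=
  .app (fn1 fun
    | .data .Write [t, _, _, _] => some t
    | .data .Read [t, _, _] => some t
    | _ => none) [e]

/-- The value of the last write access of thread `e₃` to location `e₂` in the list `e₁`, if any. -/
def getWriteValueFor (e₁ e₂ e₃ : Expr) : Expr :=
  .app (fn3 fun l x t => l.toList.map fun l =>
    match l.reverse.findSome? (fun
      | .data .Write [t', x', v, _] => if t' = t ∧ x' = x then some v else none
      | _ => none) with
    | some v => .data .Just [v]
    | none => .data .Nothing []) [e₁, e₂, e₃]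

/-! ## The class `Mem` -/

def block : List Stmt → Stmt
  | [] => .skip
  | [s] => s
  | s :: l => .seq s (block l)

/-- `x = e` for a local variable and for a field, and `x = this.m(args)`. -/
def setVar (x : Ident) (e : Expr) : Stmt := .assign (.var x) (.pure e)
def setField (x : Ident) (e : Expr) : Stmt := .assign (.field x) (.pure e)
def callThis (x m : Ident) (args : List Expr) : Stmt := .assign (.var x) (.sync .this m args)

/-- `foreach (x < e) { s }` -/
def foreach (x : Ident) (e : Expr) (s : Stmt) : Stmt :=
  block [setVar x (int 0), .while (lt (.var x) e) (block [s, setVar x (plus (.var x) (int 1))])]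

/-- A product of the product line, together with what the model leaves open: the initial contents of
the memory and the function by which the next position is chosen from the list of allowed
positions. -/
structure MemConfig where
  wwFeature : Bool
  wrFeature : Bool
  readEarlyFeature : Bool
  initialMem : Value
  nextPos : List Value → Set Value

namespace Mem

def read : Method where
  params := [.t, .loc]
  body := block [
    setVar .myId (.field .counter),
    setField .list (appendright (.field .list) (con .Read [.var .t, .var .loc, .var .myId])),
    setField .counter (plus (.field .counter) (int 1)),
    .assign (.var .result) (.call .this .internalRead [.var .myId]),
    .return (.var .result)]

def internalRead : Method where
  params := [.myId]
  body := block [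
    .await (.cond (contains (.field .done) (.var .myId))),
    .return (lookupUnsafe (.field .ret) (.var .myId))]

def write : Method where
  params := [.t, .loc, .val]
  body := block [
    setVar .myId (.field .counter),
    setField .list
      (appendright (.field .list) (con .Write [.var .t, .var .loc, .var .val, .var .myId])),
    setField .counter (plus (.field .counter) (int 1))]

def const : Method where
  params := [.i]
  body := .return (.var .i)

def run (cfg : MemConfig) : Method where
  params := []
  body := .while (.lit (.bool true)) (block [
    .await (.cond (ne (.field .list) (con .Nil []))),
    callThis .accList .strategy [],
    callThis .pp .getAccess [.app cfg.nextPos [.var .accList]],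
    .caseOf (fst (.var .pp)) (.con .Write [.bind .t, .bind .loc, .bind .val, .bind .id])
      (block [
        setField .done (insertElement (.field .done) (.var .id)),
        setField .mem (put (.field .mem) (.var .loc) (.var .val))])
    (.caseOf (fst (.var .pp)) (.con .Read [.bind .t, .bind .loc, .bind .id])
      (block [
        setField .done (insertElement (.field .done) (.var .id)),
        setField .ret (put (.field .ret) (.var .id) (snd (.var .pp)))])
      .abort)])

def strategy : Method where
  params := []
  body := block [
    setVar .allowed (con .Nil []),
    foreach .i (length (.field .list)) (block [
      setVar .add (.lit (.bool true)),
      foreach .j (.var .i) (block [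
        callThis .b .maySwap [nth (.field .list) (.var .j), nth (.field .list) (.var .i)],
        .ite (not (.var .b)) (setVar .add (.lit (.bool false))) .skip]),
      .ite (.var .add) (setVar .allowed (con .Cons [.var .i, .var .allowed])) .skip]),
    .return (.var .allowed)]

/-- Gets the access at the given position, with the value read if it is a read access, and removes it
from the list. -/
def getAccess : Method where
  params := [.pos]
  body := block [
    setVar .acc (nth (.field .list) (.var .pos)),
    setVar .value (int 0),
    .caseOf (.var .acc) (.con .Read [.bind .t, .bind .loc, .wild])
      (callThis .value .getValueFor [.var .t, .var .loc, .var .pos])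
      .skip,
    setField .list (removeAt (.field .list) (.var .pos)),
    .return (con .Pair [.var .acc, .var .value])]

def getValueForCore : Method where
  params := [.tid, .loc, .pos]
  body := .return (lookupUnsafe (.field .mem) (.var .loc))

/-- The delta that allows a thread to read its own writes early. -/
def getValueForReadEarly : Method where
  params := [.tid, .loc, .pos]
  body := .caseOf
    (getWriteValueFor (slice (.field .list) (int 0) (minus (.var .pos) (int 1)))
      (.var .loc) (.var .tid)) (.con .Just [.bind .val])
    (.return (.var .val))
    (block [
      callThis .result .getValueForCore [.var .tid, .var .loc, .var .pos],
      .return (.var .result)])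

def maySwapCore : Method where
  params := [.a, .b]
  body := .return (ne (tidOf (.var .a)) (tidOf (.var .b)))

/-- Deltas of `maySwap` take the name of the original method.  This one has the cases
`a = Write(_, loca, _, _)`, `b = Read(_, locb, _)` (first statement) and
`a = Write(_, loca, _, _)`, `b = Write(_, locb, _, _)` (second statement), and calls the original
method in all other cases. -/
def maySwapDelta (original : Ident) (writeRead writeWrite : Stmt) : Method where
  params := [.a, .b]
  body := block [
    setVar .ret (.lit (.bool false)),
    .caseOf (.var .a) (.con .Read [.wild, .wild, .wild])
      (callThis .ret original [.var .a, .var .b])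
    (.caseOf (.var .a) (.con .Write [.wild, .bind .loca, .wild, .wild])
      (.caseOf (.var .b) (.con .Read [.wild, .bind .locb, .wild])
        writeRead
      (.caseOf (.var .b) (.con .Write [.wild, .bind .locb, .wild, .wild])
        writeWrite
        .abort))
      .abort),
    .return (.var .ret)]

def callOriginal (original : Ident) : Stmt := callThis .ret original [.var .a, .var .b]

/-- Swapping is also allowed for accesses to different locations. -/
def orDifferent (original : Ident) : Stmt :=
  block [
    callThis .last original [.var .a, .var .b],
    setVar .ret (or (.var .last) (ne (.var .loca) (.var .locb)))]

/-- Swapping is also allowed for accesses to the same location. -/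
def orSame (original : Ident) : Stmt :=
  .ite (eq (.var .loca) (.var .locb)) (setVar .ret (.lit (.bool true))) (callOriginal original)

def wrDelta (original : Ident) : Method :=
  maySwapDelta original (orDifferent original) (callOriginal original)

def wrOwnDelta (original : Ident) : Method :=
  maySwapDelta original (orSame original) (callOriginal original)

def wwDelta (original : Ident) : Method :=
  maySwapDelta original (callOriginal original) (orDifferent original)

/-- The deltas of `maySwap` in a product, in the order of their application. -/
def deltas (cfg : MemConfig) : List (Ident → Method) :=
  (if cfg.wwFeature then [wwDelta] else []) ++
  (if cfg.readEarlyFeature then [wrOwnDelta] else []) ++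
  (if cfg.wrFeature then [wrDelta] else [])

/-- The method `maySwap` after the application of the first `n` deltas; the previous versions are
kept under the names `maySwapVersion n`. -/
def maySwap (cfg : MemConfig) : ℕ → Option Method
  | 0 => some maySwapCore
  | n + 1 => (deltas cfg)[n]?.map fun delta => delta (.maySwapVersion n)

def methods (cfg : MemConfig) : Ident → Option Method
  | .run => some (run cfg)
  | .read => some read
  | .internalRead => some internalRead
  | .write => some write
  | .const => some const
  | .strategy => some strategy
  | .getAccess => some getAccess
  | .getValueForCore => some getValueForCore
  | .getValueFor => some (if cfg.readEarlyFeature then getValueForReadEarly else getValueForCore)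
  | .maySwapVersion n => maySwap cfg n
  | .maySwap => maySwap cfg (deltas cfg).length
  | _ => none

end Mem

/-- The class `Mem`. -/
def memClass (cfg : MemConfig) : ClassDecl where
  params := []
  init := block [
    setField .list (con .Nil []),
    setField .counter (int 0),
    setField .done (con .EmptySet []),
    setField .mem (.lit cfg.initialMem),
    setField .ret (con .EmptyMap [])]
  methods := Mem.methods cfg

end

end ABS

-- The argument classifies what a process on an instance of `Mem` can execute. Its code contains no
-- `get`, and its synchronous calls are on `this`, so such a process halts only at an `await`. There
-- are two guards: `run` waits for a nonempty list of pending accesses (`Mem.pending`), and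
-- `internalRead` waits for its identifier to be in `done` (`Mem.executed`). As `internalRead` is
-- never called synchronously inside this code, the second guard occurs only in a one-frame process
-- that has nothing left to do but return. `Reachable.memInv` establishes this classification as an
-- invariant. It constrains only stacks on instances of `Mem`, so neither typing nor the code of
-- other classes matters.
--
-- Both guards are Boolean conditions on the fields of one object, and a step of a process changes
-- no existing object but its own. Hence a dependency between two such waiting processes stays
-- within one object (`DependsOn.obj_eq`). The process depended on can leave its `await` only when
-- the object is idle, and at that moment the condition of the other process must be false, since
-- otherwise that process could continue already. Two consequences follow
-- (`not_dependsOn_of_await`). If the guard passed entails the other condition, the `await` is never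
-- left, which rules out that one waiting `run` depends on another. If only a `return` comes next,
-- the fields stay as they are and the other condition stays false, which rules out dependence on
-- `internalRead`.
--
-- So every dependency leads from an `internalRead` to a `run` (`State.MemInv.dependsOn`), and no
-- process can be both the target of one and the source of the next, as a cycle would require.

namespace ABS

/-! ## The code run by processes on instances of `Mem` -/

/-- The guard at which `run` waits. -/
noncomputable def Mem.pending : Guard := .cond (ne (.field .list) (con .Nil []))

/-- The guard at which `internalRead` waits. -/
noncomputable def Mem.executed : Guard := .cond (contains (.field .done) (.var .myId))

/-- Statements whose only guard is that of `run`, without `get`, and whose synchronous calls are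
calls on `this` of methods other than `internalRead`. -/
def Stmt.IsMemCode : Stmt → Prop
  | .skip | .abort | .suspend | .return _ => True
  | .seq s₁ s₂ => s₁.IsMemCode ∧ s₂.IsMemCode
  | .assign _ (.pure _) | .assign _ (.call _ _ _) => True
  | .assign _ (.sync e m _) => e = .this ∧ m ≠ .internalRead
  | .assign _ (.new _ _) | .assign _ (.get _) => False
  | .fetch _ _ => False
  | .await g => g = Mem.pending
  | .ite _ s₁ s₂ => s₁.IsMemCode ∧ s₂.IsMemCode
  | .while _ s => s.IsMemCode
  | .caseOf _ _ s₁ s₂ => s₁.IsMemCode ∧ s₂.IsMemCode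

/-- Stacks of processes on instances of `Mem`. -/
inductive MemStack : List Frame → Prop
  | code {fs} : (∀ f ∈ fs, ∀ st ∈ f.code, st.IsMemCode) → MemStack fs
  | called {σ d} : MemStack [⟨σ, [Mem.internalRead.body], d⟩]
  | waiting {σ d e} : MemStack [⟨σ, [.await Mem.executed, .return e], d⟩]

theorem Mem.isMemCode_maySwapDelta {original : Ident} {s₁ s₂ : Stmt}
    (ho : original ≠ .internalRead) (h₁ : s₁.IsMemCode) (h₂ : s₂.IsMemCode) :
    (Mem.maySwapDelta original s₁ s₂).body.IsMemCode := by
  simp [Mem.maySwapDelta, block, setVar, callThis, Stmt.IsMemCode, *]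

theorem Mem.isMemCode_callOriginal {original : Ident} (ho : original ≠ .internalRead) :
    (Mem.callOriginal original).IsMemCode := by
  simp [Mem.callOriginal, callThis, Stmt.IsMemCode, ho]

theorem Mem.isMemCode_orDifferent {original : Ident} (ho : original ≠ .internalRead) :
    (Mem.orDifferent original).IsMemCode := by
  simp [Mem.orDifferent, callThis, block, setVar, Stmt.IsMemCode, ho]

theorem Mem.isMemCode_orSame {original : Ident} (ho : original ≠ .internalRead) :
    (Mem.orSame original).IsMemCode := by
  simp [Mem.orSame, setVar, Mem.isMemCode_callOriginal ho, Stmt.IsMemCode]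

/-- No induction over the deltas is needed: `Stmt.IsMemCode` looks only at the name of a called
method, and a delta calls nothing but the previous version. -/
theorem Mem.isMemCode_maySwap {cfg : MemConfig} {n : ℕ} {md : Method}
    (h : Mem.maySwap cfg n = some md) : md.body.IsMemCode := by
  cases n with
  | zero =>
    obtain rfl : Mem.maySwapCore = md := by simpa [Mem.maySwap] using h
    simp [Mem.maySwapCore, Stmt.IsMemCode]
  | succ n =>
    have ho : Ident.maySwapVersion n ≠ .internalRead := by simp
    obtain ⟨delta, hd, rfl⟩ := Option.map_eq_some_iff.1 h
    have hmem := List.mem_of_getElem? hd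
    have : delta = Mem.wwDelta ∨ delta = Mem.wrOwnDelta ∨ delta = Mem.wrDelta := by
      simp only [Mem.deltas, List.mem_append] at hmem
      rcases hmem with (hmem | hmem) | hmem <;> split at hmem <;> simp_all
    rcases this with rfl | rfl | rfl
    · exact isMemCode_maySwapDelta ho (isMemCode_callOriginal ho) (isMemCode_orDifferent ho)
    · exact isMemCode_maySwapDelta ho (isMemCode_orSame ho) (isMemCode_callOriginal ho)
    · exact isMemCode_maySwapDelta ho (isMemCode_orDifferent ho) (isMemCode_callOriginal ho)

theorem Mem.isMemCode_methods {cfg : MemConfig} {m : Ident} {md : Method}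
    (h : Mem.methods cfg m = some md) (hm : m ≠ .internalRead) : md.body.IsMemCode := by
  unfold Mem.methods at h
  split at h
  -- The cases are numbered as in the method table: 3 is `internalRead`, 9 is `getValueFor`, 10 and
  -- 11 are the versions of `maySwap`, and 12 is a name without a method.
  case h_3 => exact absurd rfl hm
  case h_9 =>
    obtain rfl := Option.some.inj h
    split <;> simp [getValueForCore, getValueForReadEarly, block, callThis, Stmt.IsMemCode]
  case h_10 => exact isMemCode_maySwap h
  case h_11 => exact isMemCode_maySwap h
  case h_12 => cases h
  all_goals
    obtain rfl := Option.some.inj h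
    simp [run, read, write, const, strategy, getAccess, getValueForCore, block, setVar, setField,
      callThis, foreach, Stmt.IsMemCode, pending]

theorem MemStack.start {cfg : MemConfig} {m : Ident} {md : Method}
    (h : Mem.methods cfg m = some md) (o : Oid) (vs : List Value) :
    MemStack (md.start o vs).frames := by
  by_cases hm : m = .internalRead
  · subst hm
    obtain rfl := Option.some.inj h
    exact .called
  · exact .code (by simpa [Method.start] using Mem.isMemCode_methods h hm)

theorem MemStack.classStart (cfg : MemConfig) (o : Oid) :
    MemStack ((memClass cfg).start o).frames := by
  refine .code ?_
  simp [ClassDecl.start, memClass, Mem.methods, block, setField, Stmt.IsMemCode]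

/-- Continuing after a first statement that leaves no code behind. -/
theorem MemStack.tail {σ σ' : Store} {st : Stmt} {k : List Stmt} {d : LVal} {fs : List Frame}
    (h : MemStack (⟨σ, st :: k, d⟩ :: fs)) : MemStack (⟨σ', k, d⟩ :: fs) := by
  cases h with
  | code h =>
    simp only [List.forall_mem_cons] at h
    exact .code (List.forall_mem_cons.2 ⟨h.1.2, h.2⟩)
  | called => exact .code (by simp)
  -- Once the guard of `internalRead` is passed, only a `return` is left, and this is ordinary code.
  | waiting => exact .code (by simp [Stmt.IsMemCode])

/-- The only step that brings in new code is a synchronous call, and it never calls `internalRead`.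
Therefore `Mem.executed` cannot appear above other frames. A fresh `internalRead` can only unfold
its body, and at its `await` there is no local step. -/
theorem MemStack.localStep {cfg : MemConfig} {self : Oid} {φ φ' : Store} {fs fs' : List Frame}
    (h : MemStack fs) (hl : LocalStep (Mem.methods cfg) self φ fs φ' fs') : MemStack fs' := by
  cases h with
  | code h =>
    refine .code ?_
    cases hl with
    | selfCall ho hvs hm hlen =>
      have hc := (h _ List.mem_cons_self _ List.mem_cons_self).2
      have := Mem.isMemCode_methods hm hc
      simp only [List.forall_mem_cons] at h ⊢
      simp only [this, List.not_mem_nil]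
      tauto
    | _ =>
      simp [Stmt.IsMemCode] at h ⊢
      tauto
  | called =>
    cases hl
    exact .waiting
  | waiting => cases hl

/-! ## The invariant of reachable states -/

/-- All processes run on existing objects, those on instances of `Mem` with a stack of this
class. -/
def State.MemInv (s : State) : Prop :=
  ∀ p pr, s.procs p = some pr →
    ∃ ob, s.objs pr.obj = some ob ∧ (ob.cls = some .Mem → MemStack pr.frames)

theorem State.MemInv.setProc {s : State} (h : s.MemInv) {p : Pid} {pr : Proc} {ob : Obj}
    (ho : s.objs pr.obj = some ob) (hf : ob.cls = some .Mem → MemStack pr.frames) :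
    (s.setProc p pr).MemInv := by
  intro q pr' hq
  by_cases hqp : q = p
  · subst hqp
    obtain rfl : pr = pr' := by simpa [State.setProc] using hq
    exact ⟨ob, ho, hf⟩
  · exact h q pr' (by simpa [State.setProc, hqp] using hq)

/-- For a fresh `o` the hypothesis is vacuous. The update is still harmless because, by the
invariant, every process runs on an existing object, so none runs on `o`; this is why `State.MemInv`
includes existence. -/
theorem State.MemInv.setObj {s : State} (h : s.MemInv) {o : Oid} {ob' : Obj}
    (hc : ∀ ob, s.objs o = some ob → ob'.cls = ob.cls) : (s.setObj o ob').MemInv := by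
  intro q pr hq
  obtain ⟨ob, ho, hf⟩ := h q pr hq
  by_cases hoq : pr.obj = o
  · exact ⟨ob', by simp [State.setObj, hoq], fun hm => hf (hc ob (hoq ▸ ho) ▸ hm)⟩
  · exact ⟨ob, by simpa [State.setObj, hoq] using ho, hf⟩

/-- Objects keep their class, and a process started on an instance of `Mem` by whatever caller gets
its code from the method table or the initialization of `Mem`. The steps that could spoil a stack,
remote synchronous calls and `get`, do not occur in this code. -/
theorem State.MemInv.step {cfg : MemConfig} {P : Program}
    (hMem : P.classes .Mem = some (memClass cfg)) {p : Pid} {s s' : State}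
    (h : s.MemInv) (hstep : Step P p s s') : s'.MemInv := by
  have hmeth : ∀ C, C = some Ident.Mem → P.method C = Mem.methods cfg := by
    rintro _ rfl
    funext m
    simp [Program.method, hMem, memClass]
  have key : ∀ {o fs ob}, s.procs p = some ⟨o, fs⟩ → s.objs o = some ob →
      ob.cls = some .Mem → MemStack fs := by
    intro o fs ob hp ho hc
    obtain ⟨ob', ho', hf⟩ := h p _ hp
    obtain rfl : ob = ob' := Option.some.inj (ho.symm.trans ho')
    exact hf hc
  have upd : ∀ {o ob}, s.objs o = some ob → ∀ φ a, (s.setObj o ⟨ob.cls, φ, a⟩).MemInv :=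
    fun ho φ a => h.setObj fun ob' ho' => by rw [Option.some.inj (ho.symm.trans ho')]
  have self : ∀ {s : State} {o : Oid} {ob : Obj}, (s.setObj o ob).objs o = some ob := by
    simp [State.setObj]
  cases hstep with
  | @call o ob σ x _ _ _ k d fs o' ob' md vs q hp ho ha he hvs ho' hm hl hq hq' =>
    have hinv := (upd ho (x.putField (.fut q) ob.fields) ob.active).setProc (p := p)
      (pr := ⟨o, ⟨x.putLocal (.fut q) σ, k, d⟩ :: fs⟩)
      (ob := { ob with fields := x.putField (.fut q) ob.fields }) self
      fun hc => (key hp ho hc).tail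
    have hstart : ob'.cls = some .Mem → MemStack (md.start o' vs).frames :=
      fun hc => .start (hmeth _ hc ▸ hm) _ _
    -- The called object may be the caller's own, whose record has just been updated.
    by_cases hoo : o' = o
    · subst hoo
      obtain rfl : ob = ob' := Option.some.inj (ho.symm.trans ho')
      exact hinv.setProc (ob := { ob with fields := x.putField (.fut q) ob.fields }) self hstart
    · exact hinv.setProc (by simpa [State.setObj, State.setProc, Method.start, hoo] using ho')
        hstart
  | @remoteSync o ob _ _ _ _ _ _ _ _ o' ob' _ _ _ hp ho ha he hne hvs ho' hm hl hq hq' =>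
    refine (h.setProc ho fun hc => ?_).setProc ho' fun hc => .start (hmeth _ hc ▸ hm) _ _
    cases key hp ho hc with
    | code hcode =>
      -- The callee expression is `this`, whose only value is the process's own object, contrary to
      -- `hne`.
      have := (hcode _ List.mem_cons_self _ List.mem_cons_self).1
      subst this
      simp [Expr.vals, hne] at he
  | @new o ob _ x _ _ _ _ _ o' cd _ _ hp ho ha hvs hC hl ho' hq hq' =>
    refine (((upd ho _ _).setProc (ob := { ob with fields := x.putField (.obj o') ob.fields }) self
      fun hc => (key hp ho hc).tail).setObj ?_).setProc (ob := ⟨some _, _, _⟩) self fun hc => ?_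
    · intro ob₁ h₁
      have hoo : o' ≠ o := by rintro rfl; simp [ho] at ho'
      simp [State.setObj, State.setProc, hoo, ho'] at h₁
    · obtain rfl := Option.some.inj hc
      obtain rfl := Option.some.inj (hMem.symm.trans hC)
      exact .classStart cfg _
  | get hp ho ha he =>
    refine h.setProc ho fun hc => ?_
    cases key hp ho hc with
    | code hcode => exact (hcode _ List.mem_cons_self _ List.mem_cons_self).elim
  | fetch hp ho ha hv => exact (upd ho _ _).setProc self fun hc => (key hp ho hc).tail
  | suspend hp ho ha => exact (upd ho _ _).setProc self fun hc => (key hp ho hc).tail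
  | release hp ho ha => exact upd ho _ _
  | resume hp ho ha hg => exact (upd ho _ _).setProc self fun hc => (key hp ho hc).tail
  | activate hp hk ho ha => exact upd ho _ _
  | finish hp ho ha hv => exact (upd ho _ _).setProc self fun _ => .code (by simp)
  | finishUnit hp ho ha => exact (upd ho _ _).setProc self fun _ => .code (by simp)
  | _ =>
    rename_i hp ho ha hl
    exact (upd ho _ _).setProc self fun hc => (key hp ho hc).localStep (hmeth _ hc ▸ hl)

theorem Reachable.memInv {cfg : MemConfig} {P : Program}
    (hMem : P.classes .Mem = some (memClass cfg)) {s : State} (hs : Reachable P s) :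
    s.MemInv := by
  induction hs with
  | refl =>
    intro p pr hp
    by_cases hp0 : p = 0
    · subst hp0
      obtain rfl : _ = pr := by simpa [Program.initial] using hp
      exact ⟨_, by simp [Program.initial]; rfl, by simp⟩
    · simp [Program.initial, hp0] at hp
  | tail _ hstep ih =>
    obtain ⟨p, hp⟩ := hstep
    exact ih.step hMem hp

/-! ## Dependencies of processes that wait for a Boolean condition -/

/-- The process table and the object determine the statement, guard and environment over which
`State.CondHolds` quantifies. This form is what the last field of `Interference` is compared with.
-/
theorem State.condHolds_iff {s : State} {p : Pid} {o : Oid} {ob : Obj} {σ : Store} {e : Expr}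
    {k : List Stmt} {d : LVal} {fs : List Frame}
    (hp : s.procs p = some ⟨o, ⟨σ, .await (.cond e) :: k, d⟩ :: fs⟩) (ho : s.objs o = some ob) :
    s.CondHolds p ↔ Value.bool true ∈ e.vals ⟨o, σ, ob.fields⟩ := by
  constructor
  · rintro (⟨q, ⟨_, _, _, _, _, _, h⟩, -⟩ | ⟨ob', g, env, ⟨_, _, _, _, _, h, ho', rfl⟩, hg⟩)
    · simp [hp] at h
    · simp only [hp, Option.some.injEq, Proc.mk.injEq, List.cons.injEq, Frame.mk.injEq,
        Stmt.await.injEq] at h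
      obtain ⟨rfl, ⟨rfl, ⟨rfl, rfl⟩, rfl⟩, rfl⟩ := h
      obtain rfl : ob = ob' := Option.some.inj (ho.symm.trans ho')
      exact hg
  · exact fun h => .inr ⟨ob, _, _, ⟨_, _, _, _, _, hp, ho, rfl⟩, h⟩

theorem State.mayContinue_iff {s : State} {p : Pid} {o : Oid} {ob : Obj} {σ : Store} {e : Expr}
    {k : List Stmt} {d : LVal} {fs : List Frame}
    (hp : s.procs p = some ⟨o, ⟨σ, .await (.cond e) :: k, d⟩ :: fs⟩) (ho : s.objs o = some ob) :
    s.MayContinue p ↔ Value.bool true ∈ e.vals ⟨o, σ, ob.fields⟩ ∧ ob.active = none := by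
  constructor
  · rintro (⟨q, ⟨_, _, _, _, _, _, h⟩, -⟩ | ⟨ob', g, env, ⟨_, _, _, _, _, h, ho', rfl⟩, hg, ha⟩)
    · simp [hp] at h
    · simp only [hp, Option.some.injEq, Proc.mk.injEq, List.cons.injEq, Frame.mk.injEq,
        Stmt.await.injEq] at h
      obtain ⟨rfl, ⟨rfl, ⟨rfl, rfl⟩, rfl⟩, rfl⟩ := h
      obtain rfl : ob = ob' := Option.some.inj (ho.symm.trans ho')
      exact ⟨hg, ha⟩
  · exact fun h => .inr ⟨ob, _, _, ⟨_, _, _, _, _, hp, ho, rfl⟩, h⟩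

/-- A step of `p` leaves other processes as they are. -/
theorem Step.procs_of_ne {P : Program} {p q : Pid} {s s' : State} {pr : Proc}
    (h : Step P p s s') (hqp : q ≠ p) (hq : s.procs q = some pr) : s'.procs q = some pr := by
  cases h with
  | call _ _ _ _ _ _ _ _ hq' | remoteSync _ _ _ _ _ _ _ _ _ hq' | new _ _ _ _ _ _ _ hq' =>
    have : ∀ r, s.procs r = none → q ≠ r := by rintro r hr rfl; simp [hq] at hr
    simp [State.setObj, State.setProc, hqp, hq, this _ hq']
  | _ => simp [State.setObj, State.setProc, State.setFut, hqp, hq]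

/-- A process never moves to another object. -/
theorem Step.obj_eq {P : Program} {p : Pid} {s s' : State} {pr : Proc}
    (h : Step P p s s') (hp : s.procs p = some pr) :
    ∃ fs, s'.procs p = some ⟨pr.obj, fs⟩ := by
  cases h with
  | call hp' _ _ _ _ _ _ _ hq' | remoteSync hp' _ _ _ _ _ _ _ _ hq' | new hp' _ _ _ _ _ _ hq' =>
    have : ∀ r, s.procs r = none → p ≠ r := by rintro r hr rfl; simp [hp] at hr
    obtain rfl := Option.some.inj (hp.symm.trans hp')
    exact ⟨_, by simp [State.setObj, State.setProc, this _ hq']; rfl⟩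
  | get hp' | fetch hp' | suspend hp' | resume hp' | finish hp' | finishUnit hp' =>
    obtain rfl := Option.some.inj (hp.symm.trans hp')
    exact ⟨_, by simp [State.setObj, State.setProc, State.setFut]; rfl⟩
  | release | activate => exact ⟨pr.frames, hp⟩
  | _ =>
    rename_i hp' _ _ _
    obtain rfl := Option.some.inj (hp.symm.trans hp')
    exact ⟨_, by simp [State.setObj, State.setProc]; rfl⟩

/-- A step of a process leaves other existing objects as they are. -/
theorem Step.objs_of_ne {P : Program} {p : Pid} {s s' : State} {pr : Proc} {o : Oid} {ob : Obj}
    (h : Step P p s s') (hp : s.procs p = some pr) (hne : o ≠ pr.obj)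
    (ho : s.objs o = some ob) : s'.objs o = some ob := by
  cases h with
  | new hp' _ _ _ _ _ ho' =>
    obtain rfl := Option.some.inj (hp.symm.trans hp')
    have : ∀ r, s.objs r = none → o ≠ r := by rintro r hr rfl; simp [ho] at hr
    simp_all [State.setObj, State.setProc]
  | call hp' | remoteSync hp' | get hp' | fetch hp' | suspend hp' | release hp'
  | resume hp' | activate hp' | finish hp' | finishUnit hp' =>
    obtain rfl := Option.some.inj (hp.symm.trans hp')
    simp_all [State.setObj, State.setProc, State.setFut]
  | _ =>
    rename_i hp' _ _ _
    obtain rfl := Option.some.inj (hp.symm.trans hp')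
    simp_all [State.setObj, State.setProc]

/-- A process that waits for a Boolean condition does not depend on processes on other objects. -/
theorem DependsOn.obj_eq {P : Program} {s : State} {p₁ p₂ : Pid} (h : DependsOn P s p₁ p₂)
    (hne : p₁ ≠ p₂) {o : Oid} {ob : Obj} {σ : Store} {e : Expr} {k : List Stmt} {d : LVal}
    {fs : List Frame} (hp₁ : s.procs p₁ = some ⟨o, ⟨σ, .await (.cond e) :: k, d⟩ :: fs⟩)
    (ho : s.objs o = some ob) {pr : Proc} (hp₂ : s.procs p₂ = some pr) : o = pr.obj := by
  by_contra hoo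
  obtain ⟨hh, t, u, hexec, hstep, hu⟩ := h
  -- An execution by definition never lets `p₁` continue, so only the final step needs an argument.
  -- Up to there it suffices to keep track of the process `p₁`, the existence of its object, and the
  -- object on which `p₂` runs.
  have inv : t.procs p₁ = s.procs p₁ ∧ (∃ ob, t.objs o = some ob) ∧
      (∃ fs, t.procs p₂ = some ⟨pr.obj, fs⟩) ∧ ¬ t.MayContinue p₁ := by
    clear hstep hu
    induction hexec with
    | refl => exact ⟨rfl, ⟨ob, ho⟩, ⟨pr.frames, hp₂⟩, hh.2⟩
    | step _ hst hm ih =>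
      obtain ⟨h₁, ⟨ob', ho'⟩, ⟨fs, h₂⟩, -⟩ := ih
      exact ⟨(hst.procs_of_ne hne (h₁.trans hp₁)).trans hp₁.symm,
        ⟨ob', hst.objs_of_ne h₂ hoo ho'⟩, hst.obj_eq (pr := ⟨pr.obj, fs⟩) h₂, hm⟩
    | change _ hi hm ih =>
      obtain ⟨h₁, ⟨ob', ho'⟩, ⟨fs, h₂⟩, -⟩ := ih
      obtain ⟨ob'', h, -⟩ := hi.objs _ _ ho'
      exact ⟨hi.proc_left.trans h₁, ⟨ob'', h⟩, ⟨fs, hi.proc_right.trans h₂⟩, hm⟩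
  obtain ⟨h₁, ⟨ob', ho'⟩, ⟨fs, h₂⟩, hm⟩ := inv
  rw [hp₁] at h₁
  rw [State.mayContinue_iff (hstep.procs_of_ne hne h₁) (hstep.objs_of_ne h₂ hoo ho')] at hu
  rw [State.mayContinue_iff h₁ ho'] at hm
  exact hm hu

/-- A process that waits for a Boolean condition does not depend on a process `p₂` that waits on
the same object if this guard entails the condition, or if `p₂` terminates when it continues. -/
theorem not_dependsOn_of_await {P : Program} {s : State} {p₁ p₂ : Pid} (hne : p₁ ≠ p₂) {o : Oid}
    {ob : Obj} {σ σ₂ : Store} {e : Expr} {k k₂ : List Stmt} {d d₂ : LVal} {fs fs₂ : List Frame}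
    {g : Guard} (hp₁ : s.procs p₁ = some ⟨o, ⟨σ, .await (.cond e) :: k, d⟩ :: fs⟩)
    (hp₂ : s.procs p₂ = some ⟨o, ⟨σ₂, .await g :: k₂, d₂⟩ :: fs₂⟩)
    (ho : s.objs o = some ob) (ha : ob.active ≠ some p₂)
    (hg : (∀ futs φ, g.Ready futs ⟨o, σ₂, φ⟩ → Value.bool true ∈ e.vals ⟨o, σ, φ⟩) ∨
      (∃ e', k₂ = [.return e']) ∧ fs₂ = []) :
    ¬ DependsOn P s p₁ p₂ := by
  rintro ⟨hh, t, u, hexec, hstep, hu⟩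
  -- Either `p₂` has not left its `await`, or the condition of `p₁` is false and `p₂` is at its
  -- final `return` or has terminated.
  let J (t : State) : Prop := t.procs p₁ = s.procs p₁ ∧ ∃ ob, t.objs o = some ob ∧
    ((t.procs p₂ = s.procs p₂ ∧ ob.active ≠ some p₂) ∨
      Value.bool true ∉ e.vals ⟨o, σ, ob.fields⟩ ∧ (t.procs p₂ = some ⟨o, []⟩ ∨
        ∃ e', t.procs p₂ = some ⟨o, [⟨σ₂, [.return e'], d₂⟩]⟩))
  have jstep : ∀ t u, J t → ¬ t.MayContinue p₁ → Step P p₂ t u → J u ∧ ¬ u.MayContinue p₁ := by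
    rintro t u ⟨h₁, ob, ho, hcase⟩ hm hst
    rw [hp₁] at h₁
    have hu₁ := hst.procs_of_ne hne h₁
    rw [State.mayContinue_iff h₁ ho] at hm
    -- Any step of `p₂` leads to the second alternative of `J`, where the false condition alone
    -- keeps `p₁` from continuing.
    suffices h : ∃ ob', u.objs o = some ob' ∧
        Value.bool true ∉ e.vals ⟨o, σ, ob'.fields⟩ ∧ (u.procs p₂ = some ⟨o, []⟩ ∨
          ∃ e', u.procs p₂ = some ⟨o, [⟨σ₂, [.return e'], d₂⟩]⟩) by
      obtain ⟨ob', ho', hc, hp⟩ := h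
      refine ⟨⟨hu₁.trans hp₁.symm, ob', ho', .inr ⟨hc, hp⟩⟩, ?_⟩
      rw [State.mayContinue_iff hu₁ ho']
      exact fun h => hc h.1
    rcases hcase with ⟨h₂, hact⟩ | ⟨hc, h₂ | ⟨e', h₂⟩⟩
    · rw [hp₂] at h₂
      cases hst with
      | resume hp ho' ha' hr =>
        simp only [h₂, Option.some.injEq, Proc.mk.injEq, List.cons.injEq, Frame.mk.injEq,
          Stmt.await.injEq] at hp
        obtain ⟨rfl, ⟨rfl, ⟨rfl, rfl⟩, rfl⟩, rfl⟩ := hp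
        obtain rfl := Option.some.inj (ho.symm.trans ho')
        -- The object is idle when `p₂` resumes, so only a false condition can have stopped `p₁`.
        have hc : Value.bool true ∉ e.vals ⟨o, σ, ob.fields⟩ := fun h => hm ⟨h, ha'⟩
        rcases hg with hg | ⟨⟨e', rfl⟩, rfl⟩
        · exact absurd (hg _ _ hr) hc
        · exact ⟨{ ob with active := some p₂ }, by simp [State.setObj, State.setProc], hc,
            .inr ⟨e', by simp [State.setProc]⟩⟩
      | _ => simp_all
    · have hl : ∀ meth φ φ' fs', ¬ LocalStep meth o φ [] φ' fs' := nofun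
      cases hst <;> simp_all
    · have hl : ∀ meth φ φ' fs', ¬ LocalStep meth o φ [⟨σ₂, [.return e'], d₂⟩] φ' fs' := nofun
      cases hst with
      -- `J` does not record that `p₂` keeps control after resuming, so this case is treated too; it
      -- changes no fields.
      | activate hp hk ho' =>
        obtain ⟨rfl, -⟩ : o = _ ∧ _ := by simpa [h₂] using hp
        obtain rfl := Option.some.inj (ho.symm.trans ho')
        exact ⟨{ ob with active := some p₂ }, by simp [State.setObj], hc, .inr ⟨e', h₂⟩⟩
      | finish hp ho' =>
        obtain ⟨rfl, -⟩ : o = _ ∧ _ := by simpa [h₂] using hp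
        obtain rfl := Option.some.inj (ho.symm.trans ho')
        exact ⟨{ ob with active := none }, by simp [State.setObj, State.setProc, State.setFut], hc,
          .inl (by simp [State.setProc, State.setFut])⟩
      | _ => simp_all
  have inv : J t ∧ ¬ t.MayContinue p₁ := by
    clear hstep hu
    induction hexec with
    | refl => exact ⟨⟨rfl, ob, ho, .inl ⟨rfl, ha⟩⟩, hh.2⟩
    | step _ hst _ ih => exact jstep _ _ ih.1 ih.2 hst
    | change _ hi hm ih =>
      obtain ⟨⟨h₁, ob, ho, hcase⟩, -⟩ := ih
      obtain ⟨ob', ho', -, hact, -⟩ := hi.objs _ _ ho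
      -- Interference may rewrite the fields of the object, but not the truth of the condition of
      -- `p₁`, and it cannot give `p₂` control.
      have hc := hi.cond
      rw [State.condHolds_iff (h₁.trans hp₁) ho,
        State.condHolds_iff (hi.proc_left.trans (h₁.trans hp₁)) ho'] at hc
      refine ⟨⟨hi.proc_left.trans h₁, ob', ho', ?_⟩, hm⟩
      rwa [hi.proc_right, hact.ne, hc]
  exact (jstep _ _ inv.1 inv.2 hstep).2 hu

/-! ## Halting processes on instances of `Mem` -/

/-- The run-time form of `get` occurs in no such stack, which leaves an `await`. A fresh
`internalRead` is excluded because its body has not been unfolded yet. -/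
theorem State.MemInv.halting {s : State} (h : s.MemInv) {p : Pid} (hh : s.Halting p)
    (hr : s.RunsOn p .Mem) :
    ∃ o ob σ d, s.objs o = some ob ∧ ob.active ≠ some p ∧
      ((∃ k fs, s.procs p = some ⟨o, ⟨σ, .await Mem.pending :: k, d⟩ :: fs⟩) ∨
        ∃ e, s.procs p = some ⟨o, [⟨σ, [.await Mem.executed, .return e], d⟩]⟩) := by
  obtain ⟨pr, ob, hp, ho, hcls⟩ := hr
  have hstack : MemStack pr.frames := by
    obtain ⟨ob', ho', hf⟩ := h p pr hp
    obtain rfl := Option.some.inj (ho.symm.trans ho')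
    exact hf hcls
  rcases hh.1 with ⟨q, ⟨o, σ, x, k, d, fs, hq⟩, -⟩ | ⟨ob', g, env, ⟨o, σ, k, d, fs, hq, -⟩, hn⟩
  · obtain rfl := Option.some.inj (hp.symm.trans hq)
    cases hstack with
    | code hc => exact (hc _ List.mem_cons_self _ List.mem_cons_self).elim
  · obtain rfl := Option.some.inj (hp.symm.trans hq)
    refine ⟨o, ob, σ, d, ho, fun ha => hn ⟨_, ob, hp, ho, ha⟩, ?_⟩
    cases hstack with
    | code hc =>
      obtain rfl : g = Mem.pending := hc _ List.mem_cons_self _ List.mem_cons_self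
      exact .inl ⟨k, fs, hp⟩
    | waiting => exact .inr ⟨_, hp⟩

/-- Among halting processes on instances of `Mem`, only those of `internalRead` depend on others,
and only on those of `run`. -/
theorem State.MemInv.dependsOn {P : Program} {s : State} (h : s.MemInv) {p₁ p₂ : Pid}
    (hne : p₁ ≠ p₂) (hd : DependsOn P s p₁ p₂) (hh₂ : s.Halting p₂)
    (hr₁ : s.RunsOn p₁ .Mem) (hr₂ : s.RunsOn p₂ .Mem) :
    (∃ o σ e d, s.procs p₁ = some ⟨o, [⟨σ, [.await Mem.executed, .return e], d⟩]⟩) ∧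
      ∃ o σ k d fs, s.procs p₂ = some ⟨o, ⟨σ, .await Mem.pending :: k, d⟩ :: fs⟩ := by
  obtain ⟨o₁, ob₁, σ₁, d₁, ho₁, ha₁, h₁⟩ := h.halting hd.1 hr₁
  obtain ⟨o₂, ob₂, σ₂, d₂, ho₂, ha₂, h₂⟩ := h.halting hh₂ hr₂
  rcases h₂ with ⟨k₂, fs₂, h₂⟩ | ⟨e₂, h₂⟩
  · rcases h₁ with ⟨k₁, fs₁, h₁⟩ | ⟨e₁, h₁⟩
    · obtain rfl : o₁ = o₂ := hd.obj_eq hne h₁ ho₁ h₂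
      -- The guard of `run` reads only a field, so on one object it has the same value for all
      -- processes waiting at it.
      refine absurd hd (not_dependsOn_of_await hne h₁ h₂ ho₂ ha₂ (.inl fun futs φ hr => ?_))
      simpa [Mem.pending, Guard.Ready, ne, con, Expr.vals, Expr.valsList] using hr
    · exact ⟨⟨_, _, _, _, h₁⟩, _, _, _, _, _, h₂⟩
  · exfalso
    rcases h₁ with ⟨k₁, fs₁, h₁⟩ | ⟨e₁, h₁⟩
    all_goals
      obtain rfl : o₁ = o₂ := hd.obj_eq hne h₁ ho₁ h₂
      exact not_dependsOn_of_await hne h₁ h₂ ho₂ ha₂ (.inr ⟨⟨e₂, rfl⟩, rfl⟩) hd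

end ABS

theorem lemma1 (cfg : ABS.MemConfig) (P : ABS.Program)
    (hMem : P.classes ABS.Ident.Mem = some (ABS.memClass cfg))
    (s : ABS.State) (hs : ABS.Reachable P s) :
    ¬ ∃ (n : ℕ) (c : Fin (n + 2) → ABS.Pid),
      ABS.IsDeadlock P s c ∧ ∀ i, s.RunsOn (c i) ABS.Ident.Mem := by
  rintro ⟨n, c, ⟨hinj, hdep⟩, hruns⟩
  have hinv := hs.memInv hMem
  -- Successive indices differ because `Fin (n + 2)` has at least two elements, and `c` is
  -- injective.
  have key : ∀ i, _ := fun i => hinv.dependsOn (fun h => by simpa using hinj h) (hdep i)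
    (hdep (i + 1)).1 (hruns i) (hruns (i + 1))
  -- The process at index `0 + 1` is the target of one dependency and the source of the next, so it
  -- would be at both guards.
  obtain ⟨-, o, σ, k, d, fs, hpending⟩ := key 0
  obtain ⟨⟨o', σ', e, d', hexecuted⟩, -⟩ := key (0 + 1)
  have hguard : ABS.Mem.pending = ABS.Mem.executed := by
    have h := hpending.symm.trans hexecuted
    simp only [Option.some.injEq, ABS.Proc.mk.injEq, List.cons.injEq, ABS.Frame.mk.injEq,
      ABS.Stmt.await.injEq] at h
    exact h.2.1.2.1.1
  -- As syntax the guards already differ in their arguments, which mention the fields `list` and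
  -- `done`.
  simp [ABS.Mem.pending, ABS.Mem.executed, ABS.ne, ABS.contains] at hguard
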